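/- Let $\mathcal T=(\mathbb T,\mathsf V,\xi)$ be a strict topological theory with $T1=1$. That is: $\mathsf V=(\mathsf V,\bigvee,\otimes,k)$ is a commutative unital quantale with internal hom $\hom$ (so $x\otimes y\le z\iff x\le\hom(y,z)$); $\mathbb T=(T,m,e)$ is a monad on $\mathsf{Set}$ such that $T$ sends pullbacks to weak pullbacks and the naturality squares of $m$ are weak pullbacks; $\xi:T\mathsf V\to\mathsf V$ is a $\mathbb T$-algebra for which $\otimes:\mathsf V\times\mathsf V\to\mathsf V$ and $k:1\to\mathsf V$ are $\mathbb T$-homomorphisms; and the maps $\xi_X:\mathsf V^X\to\mathsf V^{TX}$, $\varphi\mapsto\xi\cdot T\varphi$, are monotone and natural as a transformation $P_{\mathsf V}\Rightarrow P_{\mathsf V}T$, where $P_{\mathsf V}f(\varphi)(y)=\bigvee_{f(x)=y}\varphi(x)$. *$\mathcal T$-graphs and $\mathcal T$-categories.* A $\mathcal T$-graph is a set $X$ with a map $a:TX\times X\to\mathsf V$ such that $k\le a(e(x),x)$; it is a $\mathcal T$-category if moreover $T_\xi a(\mathfrak X,\mathfrak x)\otimes a(\mathfrak x,x)\le a(m(\mathfrak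 X),x)$ for all $\mathfrak X\in TTX$, $\mathfrak x\in TX$, $x\in X$, where $T_\xi a(\mathfrak X,\mathfrak x)=\bigvee\{\xi\cdot Ta(\mathfrak w)\mid \mathfrak w\in T(TX\times X),\ T\pi_1(\mathfrak w)=\mathfrak X,\ T\pi_2(\mathfrak w)=\mathfrak x\}$. A morphism of $\mathcal T$-graphs $(X,a)\to(Y,b)$ is a map $f$ with $a(\mathfrak x,x)\le b(Tf(\mathfrak x),f(x))$; between $\mathcal T$-categories it is called a $\mathcal T$-functor, and these form the category $\mathcal T\text{-}\mathsf{Cat}$. The underlying $\mathsf V$-graph of $(X,a)$ has homs $a(e(x),y)$. A $\mathbb T$-algebra $(I,\alpha)$ is a $\mathcal T$-graph with value $k$ at $(\mathfrak i,i)$ if $\alpha(\mathfrak i)=i$ and $\bot$ otherwise. $\mathsf V$ is a $\mathcal T$-category with structure $\hom(\xi(\mathfrak v),v)$. *The functor $\mathsf V^-$.* For a $\mathcal T$-category $X=(X,a)$, let $\mathsf V^X$ be the $\mathsf V$-category of $\mathcal T$-functors $X\to\mathsf V$ with $[\varphi',\varphi]=\bigwedge_{x}\hom(\varphi'(x),\varphi(x))$.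 It is complete, and for a $\mathcal T$-functor $f:X\to Y$ the $\mathsf V$-functor $\mathsf V^f:\mathsf V^Y\to\mathsf V^X$, $\varphi\mapsto\varphi\cdot f$, preserves weighted limits; this gives a functor $\mathsf V^-:\mathcal T\text{-}\mathsf{Cat}^{\mathrm{op}}\to\mathsf V\text{-}\mathsf{Cont}$ into the category of complete $\mathsf V$-categories and $\mathsf V$-functors preserving weighted limits. The set of $\mathcal T$-functors $X\to\mathsf V$ also carries the $\mathcal T$-graph structure $$[\![\mathfrak p,\varphi]\!]=\bigwedge\{\hom(a(T\pi_1(\mathfrak q),x),\hom(\xi\cdot T\mathrm{ev}(\mathfrak q),\varphi(x)))\mid x\in X,\ \mathfrak q\in T(X\times\mathsf V^X),\ T\pi_2(\mathfrak q)=\mathfrak p\}.$$ *$\mathcal T$-frames.* Let $A$ be a $\mathcal T$-graph whose underlying $\mathsf V$-graph is a complete $\mathsf V$-category. A $\mathcal T$-weighted diagram in $A$ consists of a set $I$ with a $\mathbb T$-algebra structure and a $\mathsf V$-category structure, a $\mathsf V$-functor $h:I\to A$ and a $\mathsf V$-distributor $\psi:1\to I$ (a contravariant presheaf) such that $i\mapsto\psi(i)\otimes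 h(i)$ is a morphism of $\mathcal T$-graphs from the algebra $I$ to $A$. Let $PA$ be the $\mathsf V$-category of $\mathsf V$-distributors $1\to A$; $\theta\in PA$ is $\mathcal T$-generated if $\theta=h_*\cdot\psi$, i.e. $\theta(x)=\bigvee_i A(x,h(i))\otimes\psi(i)$, for some such diagram, and $\mathrm{Sup}_A(\theta)$ is the colimit of the identity of $A$ weighted by $\theta$. $A$ is a $\mathcal T$-frame if for every $\mathsf V$-category $I$, $\mathsf V$-distributor $\varphi:I\to1$ and $\mathsf V$-functor $h:I\to PA$ with all $h(i)$ and $\lim(\varphi,h)$ $\mathcal T$-generated, $\mathrm{Sup}_A(\lim(\varphi,h))=\lim(\varphi,\mathrm{Sup}_A\cdot h)$. A $\mathcal T$-frame homomorphism is a $\mathsf V$-functor $f:A\to B$ that preserves weighted limits and colimits of $\mathcal T$-weighted diagrams and is $\mathcal T$-compatible: for each $\mathbb T$-algebra $I$ and each morphism of $\mathcal T$-graphs $h:I\to A$, also $f\cdot h$ is a morphism of $\mathcal T$-graphs. These form the category $\mathcal T\text{-}\mathsf{Frm}$. **Statement.** The functor $\mathsf V^-:\mathcal T\text{-}\mathsf{Cat}^{\mathrm{op}}\to\mathsf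 V\text{-}\mathsf{Cont}$ factors through the forgetful functor $\mathcal T\text{-}\mathsf{Frm}\to\mathsf V\text{-}\mathsf{Cont}$: there is a functor $\Omega:\mathcal T\text{-}\mathsf{Cat}^{\mathrm{op}}\to\mathcal T\text{-}\mathsf{Frm}$ whose composite with the forgetful functor is equal to $\mathsf V^-$ and such that the underlying $\mathcal T$-graph of $\Omega(X)$ is $(\mathsf V^X,[\![-,-]\!])$ for every $\mathcal T$-category $X$. In particular each $\mathsf V^X$ is a $\mathcal T$-frame and each $\mathsf V^f$ is a $\mathcal T$-frame homomorphism. -/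

import Mathlib

universe u

open CategoryTheory Quantale

/-! ## Strict topological theories

`V` is a commutative unital quantale: the tensor is `*`, its unit `k` is `1`, and the internal hom
`hom(y, z)` is Mathlib's residuation `y ⇨ₗ z`, with `x ≤ y ⇨ₗ z ↔ x * y ≤ z`. -/

/-- The square `f ∘ p = g ∘ q` is a weak pullback of sets: it commutes, and the comparison map to
the pullback is surjective. -/
def IsWeakPullback {P X Y Z : Type u} (p : P → X) (q : P → Y) (f : X → Z) (g : Y → Z) : Prop :=
  (∀ w, f (p w) = g (q w)) ∧ ∀ x y, f x = g y → ∃ w, p w = x ∧ q w = y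

/-- `P_V f : V^X → V^Y`, the left adjoint of the inverse image `φ ↦ φ ∘ f`. -/
def pushforward {V : Type u} [CompleteLattice V] {X Y : Type u} (f : X → Y) (φ : X → V) : Y → V :=
  fun y => ⨆ x, ⨆ _ : f x = y, φ x

/-- The defining adjunction of `pushforward`. -/
theorem pushforward_le_iff {V : Type u} [CompleteLattice V] {X Y : Type u} (f : X → Y)
    (φ : X → V) (ψ : Y → V) : pushforward f φ ≤ ψ ↔ φ ≤ ψ ∘ f := by
  simp only [pushforward, Pi.le_def, iSup_le_iff, Function.comp]
  exact ⟨fun h x => h _ x rfl, fun h y x e => e ▸ h x⟩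

/-- A strict topological theory `(T, V, ξ)` over the commutative quantale `V`. -/
structure StrictTopologicalTheory (V : Type u) [CommMonoid V] [CompleteLattice V]
    [IsQuantale V] where
  /-- the monad on sets -/
  T : CategoryTheory.Monad (Type u)
  /-- the map `ξ : T V → V` -/
  ξ : T.obj V → V
  /-- `T` sends pullbacks to weak pullbacks -/
  map_pullback : ∀ {P X Y Z : Type u} (p : P ⟶ X) (q : P ⟶ Y) (f : X ⟶ Z) (g : Y ⟶ Z),
    IsPullback p q f g → IsWeakPullback (T.map p) (T.map q) (T.map f) (T.map g)
  /-- the naturality squares of the multiplication are weak pullbacks -/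
  mul_weakPullback : ∀ {X Y : Type u} (f : X ⟶ Y),
    IsWeakPullback (T.map (T.map f)) (T.μ.app X) (T.μ.app Y) (T.map f)
  /-- `(V, ξ)` is a `T`-algebra: unit law -/
  ξ_unit : ∀ v : V, ξ (T.η.app V v) = v
  /-- `(V, ξ)` is a `T`-algebra: associativity law -/
  ξ_assoc : ∀ w : T.obj (T.obj V), ξ (T.μ.app V w) = ξ (T.map (↾ξ) w)
  /-- the tensor `V × V → V` is a homomorphism of `T`-algebras -/
  ξ_tensor : ∀ w : T.obj (V × V),
    ξ (T.map (↾fun p : V × V => p.1 * p.2) w) =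
      ξ (T.map (↾(Prod.fst : V × V → V)) w) * ξ (T.map (↾(Prod.snd : V × V → V)) w)
  /-- the unit `1 → V` is a homomorphism of `T`-algebras -/
  ξ_one : ∀ o : T.obj PUnit.{u + 1}, ξ (T.map (↾fun _ : PUnit.{u + 1} => (1 : V)) o) = 1
  /-- `ξ_X : V^X → V^(T X)` is order preserving -/
  ξ_mono : ∀ {X : Type u} (φ φ' : X → V), φ ≤ φ' →
    ∀ x : T.obj X, ξ (T.map (↾φ) x) ≤ ξ (T.map (↾φ') x)
  /-- `ξ_X : V^X → V^(T X)` is natural, as a transformation `P_V ⇒ P_V ∘ T` -/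
  ξ_natural : ∀ {X Y : Type u} (f : X → Y) (φ : X → V) (y : T.obj Y),
    ξ (T.map (↾pushforward f φ) y) =
      pushforward (T.map (↾f)) (fun x : T.obj X => ξ (T.map (↾φ) x)) y

namespace StrictTopologicalTheory

variable {V : Type u} [CommMonoid V] [CompleteLattice V] [IsQuantale V]

/-- The functor `T` on sets. -/
abbrev Ob (Th : StrictTopologicalTheory V) (X : Type u) : Type u := Th.T.obj X

/-- The functor `T` on functions. -/
def map (Th : StrictTopologicalTheory V) {X Y : Type u} (f : X → Y) : Th.Ob X → Th.Ob Y :=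
  Th.T.map (↾f)

/-- The unit `e_X : X → T X`. -/
def e (Th : StrictTopologicalTheory V) {X : Type u} : X → Th.Ob X := Th.T.η.app X

/-- The multiplication `m_X : T T X → T X`. -/
def m (Th : StrictTopologicalTheory V) {X : Type u} : Th.Ob (Th.Ob X) → Th.Ob X := Th.T.μ.app X

/-- The standing assumption `T 1 = 1`. -/
class PointPreserving (Th : StrictTopologicalTheory V) : Prop where
  subsingleton : Subsingleton (Th.Ob PUnit.{u + 1})

variable (Th : StrictTopologicalTheory V)

theorem map_map {X Y Z : Type u} (f : X → Y) (g : Y → Z) (x : Th.Ob X) :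
    Th.map g (Th.map f x) = Th.map (fun a => g (f a)) x := by
  have h : Th.T.map (↾fun a => g (f a)) = Th.T.map (↾f) ≫ Th.T.map (↾g) := by
    rw [← Functor.map_comp]; rfl
  exact (ConcreteCategory.congr_hom h x).symm

theorem map_id' {X : Type u} (x : Th.Ob X) : Th.map (fun a : X => a) x = x :=
  ConcreteCategory.congr_hom (Th.T.map_id X) x

theorem map_e {X Y : Type u} (f : X → Y) (x : X) : Th.map f (Th.e x) = Th.e (f x) :=
  (ConcreteCategory.congr_hom (Th.T.η.naturality (↾f)) x).symm

theorem map_m {X Y : Type u} (f : X → Y) (x : Th.Ob (Th.Ob X)) :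
    Th.map f (Th.m x) = Th.m (Th.map (Th.map f) x) :=
  (ConcreteCategory.congr_hom (Th.T.μ.naturality (↾f)) x).symm

/-- `ξ · T φ`. -/
def ext {X : Type u} (φ : X → V) (x : Th.Ob X) : V := Th.ξ (Th.map φ x)

theorem ext_mono {X : Type u} {φ φ' : X → V} (h : ∀ x, φ x ≤ φ' x) (x : Th.Ob X) :
    Th.ext φ x ≤ Th.ext φ' x := Th.ξ_mono φ φ' h x

theorem ext_map {X Y : Type u} (f : X → Y) (φ : Y → V) (x : Th.Ob X) :
    Th.ext φ (Th.map f x) = Th.ext (fun a => φ (f a)) x := by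
  rw [ext, map_map]; rfl

theorem ext_e {X : Type u} (φ : X → V) (x : X) : Th.ext φ (Th.e x) = φ x := by
  rw [ext, map_e]; exact Th.ξ_unit _

theorem ext_mul {X : Type u} (φ φ' : X → V) (x : Th.Ob X) :
    Th.ext (fun a => φ a * φ' a) x = Th.ext φ x * Th.ext φ' x := by
  have h := Th.ξ_tensor (Th.map (fun a => (φ a, φ' a)) x)
  change Th.ext _ _ = Th.ext _ _ * Th.ext _ _ at h
  simpa only [ext_map] using h

theorem ext_const [Th.PointPreserving] {X : Type u} (v : V) (x : Th.Ob X) :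
    Th.ext (fun _ => v) x = v := by
  have h : Th.map (fun _ : X => PUnit.unit.{u + 1}) x = Th.e PUnit.unit :=
    (PointPreserving.subsingleton (Th := Th)).elim _ _
  have h2 := Th.ext_map (fun _ : X => PUnit.unit.{u + 1}) (fun _ => v) x
  rw [← h2, h, ext_e]

/-- The lax extension `T_ξ r : T X ⇸ T Y` of a `V`-matrix `r : X ⇸ Y` (written `r y x`). -/
def lax {X Y : Type u} (r : Y → X → V) (y : Th.Ob Y) (x : Th.Ob X) : V :=
  ⨆ w : {w : Th.Ob (Y × X) // Th.map Prod.fst w = y ∧ Th.map Prod.snd w = x},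
    Th.ext (fun p => r p.1 p.2) w.1

end StrictTopologicalTheory

section

variable {V : Type u} [CommMonoid V] [CompleteLattice V] [IsQuantale V]

theorem le_qhom {x y z : V} : x ≤ y ⇨ₗ z ↔ x * y ≤ z := leftMulResiduation_le_iff_mul_le

theorem qhom_mul_le (y z : V) : (y ⇨ₗ z) * y ≤ z := le_qhom.1 le_rfl

theorem one_le_qhom {y z : V} : 1 ≤ y ⇨ₗ z ↔ y ≤ z := by rw [le_qhom, one_mul]

theorem qhom_mul_qhom (x y z : V) : (x ⇨ₗ y) * (y ⇨ₗ z) ≤ x ⇨ₗ z := by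
  rw [le_qhom, mul_right_comm]
  calc (x ⇨ₗ y) * x * (y ⇨ₗ z) ≤ y * (y ⇨ₗ z) := mul_le_mul_left (qhom_mul_le x y) _
    _ = (y ⇨ₗ z) * y := mul_comm _ _
    _ ≤ z := qhom_mul_le y z

end

/-! ## `T`-graphs, `T`-categories and `T`-functors -/

section

variable {V : Type u} [CommMonoid V] [CompleteLattice V] [IsQuantale V]

/-- A `T`-graph: a set with a `T`-matrix `a`, whose entry at `𝔵 ∈ T X`, `x ∈ X` is `a 𝔵 x`, such
that `e_X ≤ a`. -/
structure TGraph (Th : StrictTopologicalTheory V) where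
  carrier : Type u
  a : Th.Ob carrier → carrier → V
  refl : ∀ x, 1 ≤ a (Th.e x) x

instance (Th : StrictTopologicalTheory V) : CoeSort (TGraph Th) (Type u) := ⟨TGraph.carrier⟩

/-- A `T`-category: a `T`-graph with `a ∘ a = m_X · T_ξ a · a ≤ a`. -/
structure TCat (Th : StrictTopologicalTheory V) extends TGraph Th where
  trans : ∀ (X : Th.Ob (Th.Ob carrier)) (y : Th.Ob carrier) (z : carrier),
    Th.lax a X y * a y z ≤ a (Th.m X) z

/-- Morphisms of `T`-graphs: `T f · a ≤ b · f`. -/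
def IsTGraphMorphism {Th : StrictTopologicalTheory V} (A B : TGraph Th) (f : A → B) : Prop :=
  ∀ x y, A.a x y ≤ B.a (Th.map f x) (f y)

/-- `T`-functors, i.e. `T`-graph morphisms between `T`-categories. -/
@[ext]
structure TFunctor {Th : StrictTopologicalTheory V} (X Y : TCat Th) where
  toFun : X.carrier → Y.carrier
  isMorphism : IsTGraphMorphism X.toTGraph Y.toTGraph toFun

instance {Th : StrictTopologicalTheory V} (X Y : TCat Th) :
    CoeFun (TFunctor X Y) (fun _ => X.carrier → Y.carrier) := ⟨TFunctor.toFun⟩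

/-- The category `T-Cat` of `T`-categories and `T`-functors. -/
instance (Th : StrictTopologicalTheory V) : Category (TCat Th) where
  Hom X Y := TFunctor X Y
  id X := ⟨fun x => x, fun x y => by rw [Th.map_id']⟩
  comp f g := ⟨fun x => g (f x), fun x y => by
    rw [← Th.map_map]; exact (f.isMorphism x y).trans (g.isMorphism _ _)⟩

/-- A `T`-algebra `(I, α)` as a `T`-graph (in fact a `T`-category), with structure `α°`: the entry
at `(𝔦, i)` is `k` if `α 𝔦 = i` and `⊥` otherwise. -/
def TGraph.ofAlgebra (Th : StrictTopologicalTheory V) (I : Th.T.Algebra) : TGraph Th where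
  carrier := I.A
  a x y := ⨆ _ : I.a x = y, 1
  refl x := by
    have h : I.a (Th.e x) = x := ConcreteCategory.congr_hom I.unit x
    simp [h]

/-- The quantale `V` as a `T`-category, with structure `hom_ξ (𝔳, v) = hom (ξ 𝔳, v)`. -/
def TCat.ofQuantale (Th : StrictTopologicalTheory V) : TCat Th where
  carrier := V
  a x v := Th.ξ x ⇨ₗ v
  refl v := one_le_qhom.2 (Th.ξ_unit v).le
  trans X y z := by
    refine le_trans (mul_le_mul_left ?_ _) (qhom_mul_qhom _ (Th.ξ y) _)
    refine iSup_le fun w => le_qhom.2 ?_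
    obtain ⟨w, rfl, rfl⟩ := w
    have h1 : Th.ξ (Th.m (Th.map Prod.fst w)) = Th.ext (fun p : Th.Ob V × V => Th.ξ p.1) w := by
      have := Th.ξ_assoc (Th.map Prod.fst w)
      exact this.trans (Th.ext_map Prod.fst Th.ξ w)
    rw [h1, ← Th.ext_mul]
    exact Th.ext_mono (fun p => qhom_mul_le _ _) w

/-! ## `V`-categories, weighted limits and colimits -/

/-- A `V`-category structure on a set. -/
structure VCatStr (V : Type u) [CommMonoid V] [CompleteLattice V] (X : Type u) where
  hom : X → X → V
  refl : ∀ x, 1 ≤ hom x x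
  trans : ∀ x y z, hom x y * hom y z ≤ hom x z

/-- A (small) `V`-category. -/
structure VCat (V : Type u) [CommMonoid V] [CompleteLattice V] where
  carrier : Type u
  str : VCatStr V carrier

instance : CoeSort (VCat V) (Type u) := ⟨VCat.carrier⟩

/-- The hom of a `V`-category. -/
abbrev VCat.hom (A : VCat V) (x y : A) : V := A.str.hom x y

/-- A function that is a `V`-functor. -/
def IsVFunctor (A B : VCat V) (f : A → B) : Prop := ∀ x y, A.hom x y ≤ B.hom (f x) (f y)

namespace VCat

/-- `φ` is a distributor `I ⇸ 1`, i.e. a covariant presheaf, a weight for limits. -/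
def IsLimitWeight (I : VCat V) (φ : I → V) : Prop := ∀ i j, φ i * I.hom i j ≤ φ j

/-- `ψ` is a distributor `1 ⇸ I`, i.e. a contravariant presheaf, a weight for colimits. -/
def IsColimitWeight (I : VCat V) (ψ : I → V) : Prop := ∀ i j, I.hom i j * ψ j ≤ ψ i

/-- `l` is a limit `lim(φ, h)` of `h` weighted by `φ`. -/
def IsLim (A : VCat V) {I : Type u} (φ : I → V) (h : I → A) (l : A) : Prop :=
  ∀ x, A.hom x l = ⨅ i, φ i ⇨ₗ A.hom x (h i)

/-- `c` is a colimit of `h` weighted by `ψ`. -/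
def IsColim (A : VCat V) {I : Type u} (ψ : I → V) (h : I → A) (c : A) : Prop :=
  ∀ x, A.hom c x = ⨅ i, ψ i ⇨ₗ A.hom (h i) x

/-- `t` is a tensor `v ⊗ x`. -/
def IsTensor (A : VCat V) (v : V) (x t : A) : Prop :=
  ∀ y, A.hom t y = v ⇨ₗ A.hom x y

/-- `A` is complete: it has all (small) weighted limits. -/
def IsComplete (A : VCat V) : Prop :=
  ∀ (I : VCat V) (φ : I → V) (h : I → A), I.IsLimitWeight φ → IsVFunctor I A h →
    ∃ l, A.IsLim φ h l

/-- The `V`-category `P A` of distributors `1 ⇸ A`, with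
`hom (θ, θ') = ⋀_x hom (θ x, θ' x)`. -/
def presheaf (A : VCat V) : VCat V where
  carrier := {θ : A → V // A.IsColimitWeight θ}
  str :=
    { hom := fun θ θ' => ⨅ x, θ.1 x ⇨ₗ θ'.1 x
      refl := fun _ => le_iInf fun _ => one_le_qhom.2 le_rfl
      trans := fun _ _ _ => le_iInf fun x =>
        (mul_le_mul' (iInf_le _ x) (iInf_le _ x)).trans (qhom_mul_qhom _ _ _) }

/-- `s` is a supremum of the presheaf `θ ∈ P A`: a colimit of the identity weighted by `θ`. -/
def IsSup (A : VCat V) (θ : A.presheaf) (s : A) : Prop := A.IsColim θ.1 (fun x : A => x) s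

/-- `f` preserves weighted limits. -/
def PreservesLims (A B : VCat V) (f : A → B) : Prop :=
  ∀ (I : VCat V) (φ : I → V) (h : I → A) (l : A), I.IsLimitWeight φ → IsVFunctor I A h →
    A.IsLim φ h l → B.IsLim φ (fun i => f (h i)) (f l)

end VCat

/-- A complete `V`-category, i.e. an object of `V-Cont`. -/
structure VCont (V : Type u) [CommMonoid V] [CompleteLattice V] [IsQuantale V] where
  toVCat : VCat V
  complete : toVCat.IsComplete

/-- Morphisms of `V-Cont`: `V`-functors that preserve all weighted limits. -/
@[ext]
structure VCont.Hom (A B : VCont V) where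
  toFun : A.toVCat → B.toVCat
  isVFunctor : IsVFunctor A.toVCat B.toVCat toFun
  preservesLims : VCat.PreservesLims A.toVCat B.toVCat toFun

/-- The category `V-Cont` of complete `V`-categories and continuous `V`-functors. -/
instance : Category (VCont V) where
  Hom A B := VCont.Hom A B
  id A := ⟨fun x => x, fun _ _ => le_rfl, fun _ _ _ _ _ _ hl => hl⟩
  comp f g := ⟨fun x => g.toFun (f.toFun x),
    fun x y => (f.isVFunctor x y).trans (g.isVFunctor _ _),
    fun I φ h l hφ hh hl => g.preservesLims I φ _ _ hφ
      (fun i j => (hh i j).trans (f.isVFunctor _ _)) (f.preservesLims I φ h l hφ hh hl)⟩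

/-! ## `T`-diagrams, `T`-colimits and `T`-frames -/

/-- A `T`-graph whose underlying `V`-graph, with homs `a (e x) y`, is a `V`-category. -/
structure TVGraph (Th : StrictTopologicalTheory V) extends TGraph Th where
  vtrans : ∀ x y z : carrier, a (Th.e x) y * a (Th.e y) z ≤ a (Th.e x) z

/-- The underlying `V`-category. -/
def TVGraph.toVCat {Th : StrictTopologicalTheory V} (A : TVGraph Th) : VCat V where
  carrier := A.carrier
  str := ⟨fun x y => A.a (Th.e x) y, A.refl, A.vtrans⟩

/-- `f` is `T`-compatible: composition with `f` preserves `T`-diagrams, i.e. `T`-graph morphisms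
from `T`-algebras. -/
def IsTCompatible {Th : StrictTopologicalTheory V} (A B : TVGraph Th)
    (f : A.carrier → B.carrier) : Prop :=
  ∀ (I : Th.T.Algebra) (h : I.A → A.carrier),
    IsTGraphMorphism (TGraph.ofAlgebra Th I) A.toTGraph h →
      IsTGraphMorphism (TGraph.ofAlgebra Th I) B.toTGraph (fun i => f (h i))

/-- A `T`-weighted diagram in `A`: a set `I` with a `T`-algebra structure and a `V`-category
structure, a `V`-functor `h : I → A` and a distributor `ψ : 1 ⇸ I` such that
`i ↦ ψ i ⊗ h i` is a `T`-graph morphism. -/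
structure TWeightedDiagram {Th : StrictTopologicalTheory V} (A : TVGraph Th) where
  alg : Th.T.Algebra
  str : VCatStr V alg.A
  h : alg.A → A.carrier
  isVFunctor : IsVFunctor ⟨alg.A, str⟩ A.toVCat h
  ψ : alg.A → V
  isWeight : VCat.IsColimitWeight ⟨alg.A, str⟩ ψ
  isMorphism : ∃ t : alg.A → A.carrier, (∀ i, A.toVCat.IsTensor (ψ i) (h i) (t i)) ∧
    IsTGraphMorphism (TGraph.ofAlgebra Th alg) A.toTGraph t

/-- `θ : 1 ⇸ A` is `T`-generated: `θ = h_* · ψ` for some `T`-weighted diagram `(h, ψ)`. -/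
def IsTGenerated {Th : StrictTopologicalTheory V} (A : TVGraph Th) (θ : A.toVCat.presheaf) :
    Prop :=
  ∃ D : TWeightedDiagram A, ∀ x, θ.1 x = ⨆ i, A.toVCat.hom x (D.h i) * D.ψ i

/-- `f` preserves `T`-colimits, i.e. colimits of `T`-weighted diagrams. -/
def PreservesTColims {Th : StrictTopologicalTheory V} (A B : TVGraph Th)
    (f : A.carrier → B.carrier) : Prop :=
  ∀ (D : TWeightedDiagram A) (c : A.carrier), A.toVCat.IsColim D.ψ D.h c →
    B.toVCat.IsColim D.ψ (fun i => f (D.h i)) (f c)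

/-- A `T`-frame: a `T`-graph whose underlying `V`-graph is a complete `V`-category, such that
`Sup_A (lim (φ, h)) = lim (φ, Sup_A · h)` for every distributor `φ : I ⇸ 1` and `V`-functor
`h : I → P A` for which all `h i` and `lim (φ, h)` are `T`-generated. (In a `V`-category suprema
and limits are determined up to isomorphism, so the equation says that a supremum of a limit is a
limit of suprema.) -/
structure TFrame (Th : StrictTopologicalTheory V) extends TVGraph Th where
  complete : toTVGraph.toVCat.IsComplete
  distrib : ∀ (I : VCat V) (φ : I → V) (h : I → toTVGraph.toVCat.presheaf)
    (l : toTVGraph.toVCat.presheaf), I.IsLimitWeight φ →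
    IsVFunctor I toTVGraph.toVCat.presheaf h → (∀ i, IsTGenerated toTVGraph (h i)) →
    toTVGraph.toVCat.presheaf.IsLim φ h l → IsTGenerated toTVGraph l →
    ∀ (s : I → toTVGraph.toVCat) (t : toTVGraph.toVCat),
      (∀ i, toTVGraph.toVCat.IsSup (h i) (s i)) → toTVGraph.toVCat.IsSup l t →
      toTVGraph.toVCat.IsLim φ s t

/-- A `T`-frame homomorphism: a `T`-compatible `V`-functor that preserves weighted limits and
`T`-weighted colimits. -/
@[ext]
structure TFrame.Hom {Th : StrictTopologicalTheory V} (A B : TFrame Th) where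
  toFun : A.carrier → B.carrier
  isVFunctor : IsVFunctor A.toVCat B.toVCat toFun
  isTCompatible : IsTCompatible A.toTVGraph B.toTVGraph toFun
  preservesLims : VCat.PreservesLims A.toVCat B.toVCat toFun
  preservesTColims : PreservesTColims A.toTVGraph B.toTVGraph toFun

/-- Since `T 1 = 1`, tensors are `T`-colimits (over the one-point algebra), so they are preserved
by every `V`-functor that preserves `T`-colimits. -/
theorem PreservesTColims.isTensor {Th : StrictTopologicalTheory V} [Th.PointPreserving]
    {A B : TVGraph Th} {f : A.carrier → B.carrier} (hf : PreservesTColims A B f)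
    {v : V} {x t : A.carrier} (ht : A.toVCat.IsTensor v x t) :
    B.toVCat.IsTensor v (f x) (f t) := by
  have hs := StrictTopologicalTheory.PointPreserving.subsingleton (Th := Th)
  let D : TWeightedDiagram A :=
    { alg :=
        { A := PUnit.{u + 1}
          a := ↾fun _ => PUnit.unit
          unit := rfl
          assoc := rfl }
      str := ⟨fun _ _ => 1, fun _ => le_rfl, fun _ _ _ => (mul_one _).le⟩
      h := fun _ => x
      isVFunctor := fun _ _ => A.refl x
      ψ := fun _ => v
      isWeight := fun _ _ => (one_mul _).le
      isMorphism := by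
        refine ⟨fun _ => t, fun _ => ht, fun y z => iSup_le fun _ => ?_⟩
        have hy : y = Th.e PUnit.unit := hs.elim _ _
        have hm : Th.map (fun _ : PUnit.{u + 1} => t) y = Th.e t := by
          rw [hy]; exact Th.map_e _ _
        exact (A.refl t).trans (congrArg (fun w => A.a w t) hm).ge }
  have h := hf D t (fun y => (ht y).trans (by
    change _ = ⨅ _ : PUnit.{u + 1}, v ⇨ₗ A.toVCat.hom x y
    rw [iInf_const]))
  intro y
  refine (h y).trans ?_
  change (⨅ _ : PUnit.{u + 1}, v ⇨ₗ B.toVCat.hom (f x) y) = _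
  rw [iInf_const]

/-- The category `T-Frm` of `T`-frames and `T`-frame homomorphisms. -/
instance (Th : StrictTopologicalTheory V) [Th.PointPreserving] : Category (TFrame Th) where
  Hom A B := TFrame.Hom A B
  id A := ⟨fun x => x, fun _ _ => le_rfl, fun _ _ h => h, fun _ _ _ _ _ _ hl => hl,
    fun _ _ hc => hc⟩
  comp {A B C} f g := ⟨fun x => g.toFun (f.toFun x),
    fun x y => (f.isVFunctor x y).trans (g.isVFunctor _ _),
    fun I h hh => g.isTCompatible I _ (f.isTCompatible I h hh),
    fun I φ h l hφ hh hl => g.preservesLims I φ _ _ hφ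
      (fun i j => (hh i j).trans (f.isVFunctor _ _)) (f.preservesLims I φ h l hφ hh hl),
    fun D c hc => by
      let D' : TWeightedDiagram B.toTVGraph :=
        { alg := D.alg
          str := D.str
          h := fun i => f.toFun (D.h i)
          isVFunctor := fun i j => (D.isVFunctor i j).trans (f.isVFunctor _ _)
          ψ := D.ψ
          isWeight := D.isWeight
          isMorphism := by
            obtain ⟨t, ht, hm⟩ := D.isMorphism
            exact ⟨fun i => f.toFun (t i), fun i => f.preservesTColims.isTensor (ht i),
              f.isTCompatible _ t hm⟩ }
      exact g.preservesTColims D' _ (f.preservesTColims D c hc)⟩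

/-- The forgetful functor `T-Frm ⥤ V-Cont`. -/
def TFrame.forget (Th : StrictTopologicalTheory V) [Th.PointPreserving] :
    TFrame Th ⥤ VCont V where
  obj A := ⟨A.toVCat, A.complete⟩
  map f := ⟨f.toFun, f.isVFunctor, f.preservesLims⟩

/-! ## The powers `V^X` -/

/-- The underlying `V`-valued function of a `T`-functor `X → V`. -/
def TFunctor.val {Th : StrictTopologicalTheory V} {X : TCat Th}
    (φ : TFunctor X (TCat.ofQuantale Th)) : X.carrier → V := φ.toFun

theorem TFunctor.ext_val {Th : StrictTopologicalTheory V} {X : TCat Th}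
    {φ φ' : TFunctor X (TCat.ofQuantale Th)} (h : ∀ x, φ.val x = φ'.val x) : φ = φ' :=
  TFunctor.ext (funext h)

theorem TFunctor.val_le {Th : StrictTopologicalTheory V} {X : TCat Th}
    (φ : TFunctor X (TCat.ofQuantale Th)) (x : Th.Ob X.carrier) (y : X.carrier) :
    X.a x y * Th.ext φ.val x ≤ φ.val y := le_qhom.1 (φ.isMorphism x y)

/-- The `T`-graph `V^X` (the value at `V` of the right adjoint of `X ⊗ -` on `T`-graphs): its
elements are the `T`-functors `X → V`, and its structure is
`⟦𝔭, φ⟧ = ⋀ {hom (a (T π₁ 𝔮, x), hom (ξ · T ev (𝔮), φ x)) | x ∈ X, 𝔮 ∈ T (X × V^X), T π₂ 𝔮 = 𝔭}`. -/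
def powGraph (Th : StrictTopologicalTheory V) (X : TCat Th) : TGraph Th where
  carrier := TFunctor X (TCat.ofQuantale Th)
  a p φ := ⨅ (q : Th.Ob (X.carrier × TFunctor X (TCat.ofQuantale Th)))
    (_ : Th.map Prod.snd q = p) (x : X.carrier),
      X.a (Th.map Prod.fst q) x ⇨ₗ (Th.ext (fun z => z.2.val z.1) q ⇨ₗ φ.val x)
  refl φ := by
    refine le_iInf fun q => le_iInf fun hq => le_iInf fun x => ?_
    rw [one_le_qhom, le_qhom]
    have hpb : IsPullback (↾fun y : X.carrier => (y, φ)) (↾fun _ : X.carrier => PUnit.unit.{u + 1})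
        (↾(Prod.snd : X.carrier × TFunctor X (TCat.ofQuantale Th) → _))
        (↾fun _ : PUnit.{u + 1} => φ) := by
      rw [Limits.Types.isPullback_iff]
      refine ⟨rfl, ?_, ?_⟩
      · rintro y y' ⟨h, -⟩
        exact congrArg Prod.fst h
      · rintro ⟨y, φ'⟩ _ h
        exact ⟨y, Prod.ext rfl h.symm, rfl⟩
    obtain ⟨r, hr, -⟩ := (Th.map_pullback _ _ _ _ hpb).2 q (Th.e PUnit.unit)
      (hq.trans (Th.map_e (fun _ : PUnit.{u + 1} => φ) PUnit.unit).symm)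
    change Th.map (fun y : X.carrier => (y, φ)) r = q at hr
    subst hr
    rw [Th.map_map, Th.ext_map]
    change X.a (Th.map (fun y => y) r) x * Th.ext φ.val r ≤ φ.val x
    rw [Th.map_id']
    exact φ.val_le r x

/-- The `V`-category `V^X`: the full sub-`V`-category of the `V`-category of covariant presheaves
on the underlying `V`-category of `X`, determined by the `T`-functors `X → V`. -/
def powVCat (Th : StrictTopologicalTheory V) (X : TCat Th) : VCat V where
  carrier := TFunctor X (TCat.ofQuantale Th)
  str :=
    { hom := fun φ φ' => ⨅ x : X.carrier, φ.val x ⇨ₗ φ'.val x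
      refl := fun _ => le_iInf fun _ => one_le_qhom.2 le_rfl
      trans := fun _ _ _ => le_iInf fun x =>
        (mul_le_mul' (iInf_le _ x) (iInf_le _ x)).trans (qhom_mul_qhom _ _ _) }

/-- Every `T`-functor `X → V` is a covariant presheaf on the underlying `V`-category of `X`. -/
theorem TFunctor.covariant {Th : StrictTopologicalTheory V} {X : TCat Th}
    (φ : TFunctor X (TCat.ofQuantale Th)) (x y : X.carrier) :
    φ.val x * X.a (Th.e x) y ≤ φ.val y := by
  have h := φ.val_le (Th.e x) y
  rwa [Th.ext_e, mul_comm] at h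

variable (Th : StrictTopologicalTheory V) [Th.PointPreserving]

/-- Weighted limits in `V^X` are computed pointwise. -/
def powLim (X : TCat Th) {I : Type u} (φ : I → V) (h : I → powVCat Th X) : powVCat Th X where
  toFun := fun x => (⨅ i, φ i ⇨ₗ TFunctor.val (h i) x : V)
  isMorphism x y := by
    change _ ≤ Th.ext (fun x => ⨅ i, φ i ⇨ₗ TFunctor.val (h i) x) x ⇨ₗ
      (⨅ i, φ i ⇨ₗ TFunctor.val (h i) y : V)
    refine le_qhom.2 (le_iInf fun i => le_qhom.2 ?_)
    refine le_trans ?_ (TFunctor.val_le (h i) x y)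
    rw [mul_assoc]
    refine mul_le_mul_right ?_ _
    rw [← Th.ext_const (φ i) x, ← Th.ext_mul]
    refine Th.ext_mono (fun z => le_qhom.1 ?_) x
    exact iInf_le _ i

theorem isLim_pow_iff (X : TCat Th) {I : Type u} (φ : I → V) (h : I → powVCat Th X)
    (l : powVCat Th X) :
    (powVCat Th X).IsLim φ h l ↔
      ∀ x : X.carrier, TFunctor.val l x = ⨅ i, φ i ⇨ₗ TFunctor.val (h i) x := by
  have key : ∀ g : powVCat Th X, (⨅ i, φ i ⇨ₗ (powVCat Th X).hom g (h i)) =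
      (powVCat Th X).hom g (powLim Th X φ h) := by
    intro g
    refine eq_of_forall_le_iff fun c => ?_
    change _ ↔ c ≤ ⨅ x : X.carrier, TFunctor.val g x ⇨ₗ ⨅ i, φ i ⇨ₗ TFunctor.val (h i) x
    simp only [le_iInf_iff, le_qhom]
    change (∀ i, c * φ i ≤ ⨅ x : X.carrier, TFunctor.val g x ⇨ₗ TFunctor.val (h i) x) ↔ _
    simp only [le_iInf_iff, le_qhom]
    exact ⟨fun H x i => by rw [mul_right_comm]; exact H i x,
      fun H i x => by rw [mul_right_comm]; exact H x i⟩
  constructor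
  · intro H x
    apply le_antisymm
    · have h1 := H l
      rw [key] at h1
      exact one_le_qhom.1 ((((powVCat Th X).str.refl l).trans h1.le).trans (iInf_le _ x))
    · have h1 := H (powLim Th X φ h)
      rw [key] at h1
      exact one_le_qhom.1
        ((((powVCat Th X).str.refl (powLim Th X φ h)).trans h1.ge).trans (iInf_le _ x))
  · intro H g
    have : l = powLim Th X φ h := TFunctor.ext_val H
    rw [key, this]

/-- The lifted representable functor `V^- : T-Catᵒᵖ ⥤ V-Cont`, sending `X` to the `V`-category
`V^X` and `f` to composition with `f`. -/
def powFunctor : (TCat Th)ᵒᵖ ⥤ VCont V where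
  obj X := ⟨powVCat Th X.unop, fun _ φ h _ _ =>
    ⟨powLim Th X.unop φ h, (isLim_pow_iff Th X.unop φ h _).2 fun _ => rfl⟩⟩
  map {X Y} f :=
    { toFun := fun φ => (f.unop ≫ φ : Y.unop ⟶ TCat.ofQuantale Th)
      isVFunctor := fun φ φ' => le_iInf fun x => iInf_le _ (TFunctor.toFun f.unop x)
      preservesLims := fun _ φ h l _ _ hl => by
        have hl := (isLim_pow_iff Th X.unop φ h l).1 hl
        exact (isLim_pow_iff Th Y.unop φ _ _).2 fun x => hl (TFunctor.toFun f.unop x) }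

end

/-! ## The underlying `V`-category of `V^X` -/

section

variable {V : Type u} [CommMonoid V] [CompleteLattice V] [IsQuantale V]

/-! Arbitrary colimits in `V^X` need not be pointwise, but colimits of `T`-weighted diagrams are,
and everything follows from this. Since `T` sends pullbacks to weak pullbacks, a `T`-graph morphism
from an algebra `I` to `V^X` amounts to a morphism `X ⊗ I → V` (`isTGraphMorphism_powGraph_iff`).
Naturality of `ξ` along `π₁ : X × I → X` then makes its pointwise supremum a `T`-functor (`powSup`).
Because `T 1 = 1`, pointwise tensors and limits are `T`-functors too, and so is each `a (𝔵, -)`;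
hence evaluation at `x` is represented by `a (e x, -)`.

For a `T`-generated presheaf `θ` the supremum is therefore pointwise, and co-Yoneda identifies its
value at `x` with `θ (a (e x, -))` (`IsTGenerated.val_sup`). Limits of presheaves are pointwise, so
evaluating `θ` at a representable commutes with them: this is the frame law. Composition with `f`
preserves all these pointwise formulas. -/

theorem powGraph_hom (Th : StrictTopologicalTheory V) (X : TCat Th)
    (φ φ' : TFunctor X (TCat.ofQuantale Th)) :
    (powGraph Th X).a (Th.e φ) φ' = ⨅ x : X.carrier, φ.val x ⇨ₗ φ'.val x := by
  apply le_antisymm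
  · refine le_iInf fun x => ?_
    have hq : Th.map Prod.snd (Th.e (x, φ)) = Th.e φ := Th.map_e _ _
    -- Testing at `𝔮 = e (x, φ)` suffices, because `k ≤ a (e x, x)`.
    refine (iInf_le_of_le (Th.e (x, φ)) (iInf_le_of_le hq (iInf_le _ x))).trans ?_
    rw [Th.map_e, Th.ext_e]
    have h := qhom_mul_le (X.a (Th.e x) x) (φ.val x ⇨ₗ φ'.val x)
    exact (le_mul_of_one_le_right' (X.refl x)).trans h
  · refine le_iInf fun q => le_iInf fun hq => le_iInf fun x => ?_
    -- Reflexivity already bounds `a (T π₁ 𝔮, x) ⊗ ξ · T ev (𝔮)` by `φ x` for every `𝔮` over `e φ`;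
    -- it remains to apply `hom (φ x, φ' x)`.
    have h1 := (powGraph Th X).refl φ
    have h2 : (1 : V) ≤ X.a (Th.map Prod.fst q) x ⇨ₗ
        (Th.ext (fun z : X.carrier × TFunctor X (TCat.ofQuantale Th) => z.2.val z.1) q ⇨ₗ
          φ.val x) :=
      h1.trans (iInf_le_of_le q (iInf_le_of_le hq (iInf_le _ x)))
    rw [one_le_qhom, le_qhom] at h2
    rw [le_qhom, le_qhom, mul_assoc]
    exact (mul_le_mul' (iInf_le _ x) h2).trans (qhom_mul_le _ _)

/-- The `T`-graph `V^X`, whose underlying `V`-graph is a `V`-category. -/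
def powTVGraph (Th : StrictTopologicalTheory V) (X : TCat Th) : TVGraph Th where
  toTGraph := powGraph Th X
  vtrans φ φ' φ'' := by
    exact (mul_le_mul' (powGraph_hom Th X φ φ').le (powGraph_hom Th X φ' φ'').le).trans
      (((powVCat Th X).str.trans φ φ' φ'').trans (powGraph_hom Th X φ φ'').ge)

/-- The two homs are different infima, so the equality is not definitional. It is needed because the
factorization of `V^-` is an equality of functors. -/
theorem powTVGraph_toVCat (Th : StrictTopologicalTheory V) (X : TCat Th) :
    (powTVGraph Th X).toVCat = powVCat Th X := by
  have h : ∀ s s' : VCatStr V (TFunctor X (TCat.ofQuantale Th)), s.hom = s'.hom →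
      (⟨_, s⟩ : VCat V) = ⟨_, s'⟩ := by
    rintro ⟨s, _, _⟩ ⟨_, _, _⟩ rfl
    rfl
  exact h _ _ (funext fun φ => funext fun φ' => powGraph_hom Th X φ φ')

theorem powTVGraph_hom (Th : StrictTopologicalTheory V) (X : TCat Th)
    (φ φ' : TFunctor X (TCat.ofQuantale Th)) :
    (powTVGraph Th X).toVCat.hom φ φ' = (powVCat Th X).hom φ φ' :=
  powGraph_hom Th X φ φ'

theorem le_powTVGraph_hom_iff {Th : StrictTopologicalTheory V} {X : TCat Th} {v : V}
    {φ φ' : TFunctor X (TCat.ofQuantale Th)} :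
    v ≤ (powTVGraph Th X).toVCat.hom φ φ' ↔ ∀ x, v * φ.val x ≤ φ'.val x := by
  refine (iff_of_eq (congrArg (v ≤ ·) (powGraph_hom Th X φ φ'))).trans ?_
  simp only [le_iInf_iff, le_qhom]

theorem isLim_powTVGraph_iff (Th : StrictTopologicalTheory V) [Th.PointPreserving] (X : TCat Th)
    {I : Type u} (φ : I → V) (h : I → TFunctor X (TCat.ofQuantale Th))
    (l : TFunctor X (TCat.ofQuantale Th)) :
    (powTVGraph Th X).toVCat.IsLim φ h l ↔
      ∀ x : X.carrier, l.val x = ⨅ i, φ i ⇨ₗ (h i).val x := by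
  refine Iff.trans ?_ (isLim_pow_iff Th X φ h l)
  exact forall_congr' fun g => iff_of_eq (congrArg₂ Eq (powTVGraph_hom Th X g l)
    (iInf_congr fun i => congrArg (φ i ⇨ₗ ·) (powTVGraph_hom Th X g (h i))))

theorem powTVGraph_isComplete (Th : StrictTopologicalTheory V) [Th.PointPreserving]
    (X : TCat Th) : (powTVGraph Th X).toVCat.IsComplete := fun _ φ h _ _ =>
  ⟨powLim Th X φ h, (isLim_powTVGraph_iff Th X φ h _).2 fun _ => rfl⟩

/-- `V^X` is separated because the order of `V` is antisymmetric. Objects given only by a universal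
property thus equal any pointwise candidate that is a `T`-functor. -/
theorem TFunctor.eq_of_hom_eq {Th : StrictTopologicalTheory V} {X : TCat Th}
    {φ φ' : TFunctor X (TCat.ofQuantale Th)}
    (h : ∀ g, (powTVGraph Th X).toVCat.hom φ g = (powTVGraph Th X).toVCat.hom φ' g) : φ = φ' := by
  refine TFunctor.ext_val fun x => le_antisymm ?_ ?_
  · simpa only [one_mul] using le_powTVGraph_hom_iff.1
      (((powTVGraph Th X).toVCat.str.refl φ').trans (h φ').ge) x
  · simpa only [one_mul] using le_powTVGraph_hom_iff.1
      (((powTVGraph Th X).toVCat.str.refl φ).trans (h φ).le) x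

/-- A `T`-functor that is a pointwise weighted colimit is a weighted colimit. -/
theorem isColim_powTVGraph_of_forall {Th : StrictTopologicalTheory V} {X : TCat Th}
    {I : Type u} {ψ : I → V} {h : I → TFunctor X (TCat.ofQuantale Th)}
    {c : TFunctor X (TCat.ofQuantale Th)} (hc : ∀ x, c.val x = ⨆ i, ψ i * (h i).val x) :
    (powTVGraph Th X).toVCat.IsColim ψ h c := by
  intro g
  refine eq_of_forall_le_iff fun v => ?_
  have h1 : (∀ x, v * c.val x ≤ TFunctor.val g x) ↔
      ∀ i x, v * ψ i * (h i).val x ≤ TFunctor.val g x := by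
    simp only [hc, mul_iSup_distrib, iSup_le_iff, mul_assoc]
    exact forall_comm
  refine le_powTVGraph_hom_iff.trans (h1.trans ?_)
  simp only [le_iInf_iff, le_qhom]
  exact forall_congr' fun i => le_powTVGraph_hom_iff.symm

theorem eq_of_isColim_powTVGraph {Th : StrictTopologicalTheory V} {X : TCat Th}
    {I : Type u} {ψ : I → V} {h : I → TFunctor X (TCat.ofQuantale Th)}
    {c c' : TFunctor X (TCat.ofQuantale Th)} (hc : (powTVGraph Th X).toVCat.IsColim ψ h c)
    (hc' : (powTVGraph Th X).toVCat.IsColim ψ h c') : c = c' :=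
  TFunctor.eq_of_hom_eq fun g => (hc g).trans (hc' g).symm

/-! ## Tensors, representables and `T`-diagrams in `V^X` -/

/-- The pointwise tensor of a `T`-functor `X → V` with an element of `V`. -/
def powTensor (Th : StrictTopologicalTheory V) [Th.PointPreserving] (X : TCat Th) (v : V)
    (φ : TFunctor X (TCat.ofQuantale Th)) : TFunctor X (TCat.ofQuantale Th) where
  toFun := fun x => (v * φ.val x : V)
  isMorphism x y := by
    change _ ≤ Th.ext (fun x => v * φ.val x) x ⇨ₗ (v * φ.val y : V)
    -- `T 1 = 1` enters through `ext_const`: the extension of a constant function is constant with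
    -- the same value.
    rw [le_qhom, Th.ext_mul, Th.ext_const, mul_left_comm]
    exact mul_le_mul_right (φ.val_le x y) v

theorem VCat.IsTensor.eq_powTensor {Th : StrictTopologicalTheory V} [Th.PointPreserving]
    {X : TCat Th} {v : V} {φ t : TFunctor X (TCat.ofQuantale Th)}
    (ht : (powTVGraph Th X).toVCat.IsTensor v φ t) : t = powTensor Th X v φ := by
  refine TFunctor.eq_of_hom_eq fun g => (ht g).trans ?_
  refine eq_of_forall_le_iff fun w => le_qhom.trans (le_powTVGraph_hom_iff.trans
    (Iff.trans ?_ le_powTVGraph_hom_iff.symm))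
  exact forall_congr' fun x => iff_of_eq (congrArg (· ≤ TFunctor.val g x) (mul_assoc _ _ _))

/-- Since `T 1 = 1`, each `a (𝔵, -)` is a `T`-functor `X → V`. -/
def powRepresentable (Th : StrictTopologicalTheory V) [Th.PointPreserving] (X : TCat Th)
    (p : Th.Ob X.carrier) : TFunctor X (TCat.ofQuantale Th) where
  toFun := fun x => (X.a p x : V)
  isMorphism y z := by
    change _ ≤ Th.ext (X.a p) y ⇨ₗ X.a p z
    have hs := StrictTopologicalTheory.PointPreserving.subsingleton (Th := Th)
    -- The constant map at `p` factors through the one-point set, and `T 1 = 1` leaves only the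
    -- image of its unit.
    have h1 : Th.map (fun _ : X.carrier => p) y = Th.e p := by
      have h : Th.map (fun _ : X.carrier => PUnit.unit.{u + 1}) y = Th.e PUnit.unit :=
        hs.elim _ _
      rw [← Th.map_e (fun _ : PUnit.{u + 1} => p) PUnit.unit, ← h, Th.map_map]
    have hm : Th.m (Th.e p) = p :=
      ConcreteCategory.congr_hom (Th.T.left_unit X.carrier) p
    -- The image of `y` under `T (p, -)` is a witness over `(e p, y)` in the supremum defining `T_ξ
    -- a (e p, y)`; transitivity with `m (e p) = p` then gives the claim.
    have hw : Th.map Prod.fst (Th.map (fun x : X.carrier => (p, x)) y) = Th.e p ∧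
        Th.map Prod.snd (Th.map (fun x : X.carrier => (p, x)) y) = y := by
      rw [Th.map_map, Th.map_map]
      exact ⟨h1, Th.map_id' y⟩
    have h2 : Th.ext (X.a p) y ≤ Th.lax X.a (Th.e p) y := by
      refine le_trans (le_of_eq ?_)
        (le_iSup (fun w : {w : Th.Ob (Th.Ob X.carrier × X.carrier) //
          Th.map Prod.fst w = Th.e p ∧ Th.map Prod.snd w = y} =>
            Th.ext (fun p => X.a p.1 p.2) w.1) ⟨_, hw⟩)
      rw [Th.ext_map]
    have h3 := X.trans (Th.e p) y z
    rw [hm] at h3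
    rw [le_qhom, mul_comm]
    exact (mul_le_mul_left h2 _).trans h3

/-- The Yoneda lemma: evaluation at `x` is represented by `a (e x, -)`. -/
theorem powTVGraph_hom_representable (Th : StrictTopologicalTheory V) [Th.PointPreserving]
    (X : TCat Th) (x : X.carrier) (φ : TFunctor X (TCat.ofQuantale Th)) :
    (powTVGraph Th X).toVCat.hom (powRepresentable Th X (Th.e x)) φ = φ.val x := by
  rw [powTVGraph_hom]
  change (⨅ y, X.a (Th.e x) y ⇨ₗ φ.val y) = φ.val x
  apply le_antisymm
  · exact (iInf_le _ x).trans
      ((le_mul_of_one_le_right' (X.refl x)).trans (qhom_mul_le _ _))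
  · exact le_iInf fun y => le_qhom.2 (φ.covariant x y)

/-- The presheaf evaluated at a representable, by the co-Yoneda lemma. -/
theorem iSup_presheaf_mul_val {Th : StrictTopologicalTheory V} [Th.PointPreserving]
    {X : TCat Th} (θ : (powTVGraph Th X).toVCat.presheaf) (x : X.carrier) :
    (⨆ φ : TFunctor X (TCat.ofQuantale Th), θ.1 φ * φ.val x) =
      θ.1 (powRepresentable Th X (Th.e x)) := by
  apply le_antisymm
  · refine iSup_le fun φ => ?_
    rw [← powTVGraph_hom_representable, mul_comm]
    exact θ.2 _ φ
  · exact (le_mul_of_one_le_right' (X.refl x)).trans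
      (le_iSup (fun φ : TFunctor X (TCat.ofQuantale Th) => θ.1 φ * φ.val x)
        (powRepresentable Th X (Th.e x)))

/-- `T`-diagrams in `V^X` are the `T`-graph morphisms `X ⊗ I → V`. -/
theorem isTGraphMorphism_powGraph_iff {Th : StrictTopologicalTheory V} {X : TCat Th}
    {I : Th.T.Algebra} {h : I.A → TFunctor X (TCat.ofQuantale Th)} :
    IsTGraphMorphism (TGraph.ofAlgebra Th I) (powGraph Th X) h ↔
      ∀ (r : Th.Ob (X.carrier × I.A)) (x : X.carrier),
        X.a (Th.map Prod.fst r) x * Th.ext (fun z => (h z.2).val z.1) r ≤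
          (h (I.a (Th.map Prod.snd r))).val x := by
  constructor
  · intro H r x
    have h1 : (1 : V) ≤ _ := (le_iSup (fun _ => (1 : V)) rfl).trans
      (H (Th.map Prod.snd r) (I.a (Th.map Prod.snd r)))
    have h2 := h1.trans (iInf_le_of_le (Th.map (fun z : X.carrier × I.A => (z.1, h z.2)) r)
      (iInf_le_of_le ((Th.map_map _ _ _).trans (Th.map_map Prod.snd h r).symm) (iInf_le _ x)))
    rw [one_le_qhom, le_qhom, Th.map_map, Th.ext_map] at h2
    exact h2
  · intro H i j
    refine iSup_le fun hij => ?_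
    refine le_iInf fun q => le_iInf fun hq => le_iInf fun x => ?_
    rw [one_le_qhom, le_qhom]
    -- `id × h` is the pullback of `h` along the projection from `X × V^X`, so a `𝔮` over `T h (𝔦)`
    -- lifts to some `r ∈ T (X × I)` over `𝔦`.
    have hpb : IsPullback (↾fun z : X.carrier × I.A => (z.1, h z.2))
        (↾(Prod.snd : X.carrier × I.A → I.A))
        (↾(Prod.snd : X.carrier × TFunctor X (TCat.ofQuantale Th) → _)) (↾h) := by
      rw [Limits.Types.isPullback_iff]
      refine ⟨rfl, ?_, ?_⟩
      · rintro ⟨y, i⟩ ⟨y', i'⟩ ⟨h1, h2⟩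
        exact Prod.ext
          (congrArg (fun z : X.carrier × TFunctor X (TCat.ofQuantale Th) => z.1) h1) h2
      · rintro ⟨y, φ⟩ i hi
        exact ⟨(y, i), Prod.ext rfl hi.symm, rfl⟩
    obtain ⟨r, hr, hr'⟩ := (Th.map_pullback _ _ _ _ hpb).2 q i hq
    change Th.map (fun z : X.carrier × I.A => (z.1, h z.2)) r = q at hr
    change Th.map Prod.snd r = i at hr'
    subst hr hr' hij
    rw [Th.map_map, Th.ext_map]
    exact H r x

/-- The pointwise supremum of a `T`-diagram in `V^X` is a `T`-functor. -/
def powSup {Th : StrictTopologicalTheory V} {X : TCat Th} {I : Th.T.Algebra}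
    (t : I.A → TFunctor X (TCat.ofQuantale Th))
    (ht : IsTGraphMorphism (TGraph.ofAlgebra Th I) (powGraph Th X) t) :
    TFunctor X (TCat.ofQuantale Th) where
  toFun := fun x => (⨆ i, (t i).val x : V)
  isMorphism x y := by
    change _ ≤ Th.ext (fun x => ⨆ i, (t i).val x) x ⇨ₗ (⨆ i, (t i).val y : V)
    -- Written as a pushforward along `π₁`, the pointwise supremum has its extension computed by
    -- naturality of `ξ`, as a supremum over all `r ∈ T (X × I)` lying over `x`.
    have h1 : (fun x => ⨆ i, (t i).val x) =
        pushforward Prod.fst (fun z : X.carrier × I.A => (t z.2).val z.1) := by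
      funext x
      apply le_antisymm
      · exact iSup_le fun i => le_iSup₂_of_le (x, i) rfl le_rfl
      · exact iSup₂_le fun z hz => hz ▸ le_iSup (fun i => (t i).val z.1) z.2
    have h2 := Th.ξ_natural Prod.fst (fun z : X.carrier × I.A => (t z.2).val z.1) x
    rw [← h1] at h2
    change Th.ext _ x = ⨆ r, ⨆ _ : Th.map Prod.fst r = x, Th.ext _ r at h2
    rw [le_qhom, h2]
    simp only [mul_iSup_distrib, iSup_le_iff]
    rintro r
    rw [mul_comm, ← le_qhom]
    refine iSup_le ?_
    rintro rfl
    rw [le_qhom, mul_comm]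
    -- The term of `r` is bounded by the member of the family with index `α (T π₂ r)`.
    exact (isTGraphMorphism_powGraph_iff.1 ht r y).trans
      (le_iSup (fun i => (t i).val y) _)

/-- `T`-colimits in `V^X` are computed pointwise. -/
theorem isColim_diagram_powTVGraph_iff {Th : StrictTopologicalTheory V} [Th.PointPreserving]
    {X : TCat Th} (D : TWeightedDiagram (powTVGraph Th X))
    (c : TFunctor X (TCat.ofQuantale Th)) :
    (powTVGraph Th X).toVCat.IsColim D.ψ D.h c ↔
      ∀ x, c.val x = ⨆ i, D.ψ i * TFunctor.val (D.h i) x := by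
  refine ⟨fun hc => ?_, isColim_powTVGraph_of_forall⟩
  obtain ⟨t, ht, hm⟩ := D.isMorphism
  have hs : ∀ x, (powSup t hm).val x = ⨆ i, D.ψ i * TFunctor.val (D.h i) x := fun x =>
    iSup_congr fun i => congrArg (fun φ => TFunctor.val φ x) (ht i).eq_powTensor
  -- The pointwise formula defines a `T`-functor, hence a colimit; by separatedness it is the given
  -- one.
  rw [eq_of_isColim_powTVGraph hc (isColim_powTVGraph_of_forall hs)]
  exact hs

/-- The supremum of a `T`-generated presheaf on `V^X` is given by evaluation at representables. -/
theorem IsTGenerated.val_sup {Th : StrictTopologicalTheory V} [Th.PointPreserving]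
    {X : TCat Th} {θ : (powTVGraph Th X).toVCat.presheaf}
    (hθ : IsTGenerated (powTVGraph Th X) θ) {s : TFunctor X (TCat.ofQuantale Th)}
    (hs : (powTVGraph Th X).toVCat.IsSup θ s) (x : X.carrier) :
    s.val x = θ.1 (powRepresentable Th X (Th.e x)) := by
  obtain ⟨D, hD⟩ := hθ
  have hx : ∀ x, θ.1 (powRepresentable Th X (Th.e x)) =
      ⨆ i, D.ψ i * TFunctor.val (D.h i) x := fun x => by
    refine (hD _).trans (iSup_congr fun i => ?_)
    exact (congrArg (· * D.ψ i) (powTVGraph_hom_representable Th X x (D.h i))).trans (mul_comm _ _)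
  obtain ⟨t, ht, hm⟩ := D.isMorphism
  -- The pointwise colimit of the generating diagram is also that of the identity weighted by `θ`:
  -- both have the value of `θ` at the representable of `x`.
  have hc : ∀ x, (powSup t hm).val x =
      ⨆ φ : TFunctor X (TCat.ofQuantale Th), θ.1 φ * φ.val x := fun x => by
    rw [iSup_presheaf_mul_val, hx]
    exact iSup_congr fun i => congrArg (fun φ => TFunctor.val φ x) (ht i).eq_powTensor
  rw [eq_of_isColim_powTVGraph hs (isColim_powTVGraph_of_forall hc), hc, iSup_presheaf_mul_val]

end

/-! ### Limits in presheaf `V`-categories -/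

section

variable {V : Type u} [CommMonoid V] [CompleteLattice V] [IsQuantale V]

/-- Weighted limits of presheaves are computed pointwise. -/
theorem VCat.IsLim.presheaf_apply {A : VCat V} {I : Type u} {φ : I → V} {h : I → A.presheaf}
    {l : A.presheaf} (hl : VCat.IsLim A.presheaf φ h l) (x : A) :
    l.1 x = ⨅ i, φ i ⇨ₗ (h i).1 x := by
  have hp : A.IsColimitWeight fun x => ⨅ i, φ i ⇨ₗ (h i).1 x := fun x y =>
    le_iInf fun i => le_qhom.2 <| by
      have hi : (⨅ i, φ i ⇨ₗ (h i).1 y) * φ i ≤ (h i).1 y := le_qhom.1 (iInf_le _ i)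
      rw [mul_assoc]
      exact (mul_le_mul_right hi _).trans ((h i).2 x y)
  have key : ∀ g : A.presheaf, A.presheaf.hom g l =
      ⨅ x, g.1 x ⇨ₗ ⨅ i, φ i ⇨ₗ (h i).1 x := fun g => by
    rw [hl g]
    refine eq_of_forall_le_iff fun c => ?_
    change (c ≤ ⨅ i, φ i ⇨ₗ ⨅ x, g.1 x ⇨ₗ (h i).1 x) ↔ _
    simp only [le_iInf_iff, le_qhom]
    exact ⟨fun H x i => by rw [mul_right_comm]; exact H i x,
      fun H i x => by rw [mul_right_comm]; exact H x i⟩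
  apply le_antisymm
  · exact one_le_qhom.1 (((A.presheaf.str.refl l).trans (key l).le).trans (iInf_le _ x))
  · have h1 : (1 : V) ≤ A.presheaf.hom ⟨_, hp⟩ l :=
      (A.presheaf.str.refl ⟨_, hp⟩).trans (key ⟨_, hp⟩).ge
    exact one_le_qhom.1 (h1.trans (iInf_le _ x))

/-! ## The `T`-frame `V^X` -/

variable (Th : StrictTopologicalTheory V) [Th.PointPreserving]

/-- The `T`-frame `V^X`. -/
def powFrame (X : TCat Th) : TFrame Th where
  toTVGraph := powTVGraph Th X
  complete := powTVGraph_isComplete Th X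
  distrib I φ h l _ _ hh hl hlg s t hs ht := by
    refine (isLim_powTVGraph_iff Th X φ s t).2 fun x => ?_
    -- At `x`, each supremum becomes the value of its presheaf at `a (e x, -)`, where the limit `l`
    -- is pointwise.
    refine (hlg.val_sup ht x).trans ((hl.presheaf_apply _).trans (iInf_congr fun i => ?_))
    exact congrArg (φ i ⇨ₗ ·) ((hh i).val_sup (hs i) x).symm

/-- Composition with a `T`-functor, as a `T`-frame homomorphism. -/
def powFrameMap {X Y : TCat Th} (f : Y ⟶ X) : TFrame.Hom (powFrame Th X) (powFrame Th Y) where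
  toFun := fun φ => (f ≫ φ : Y ⟶ TCat.ofQuantale Th)
  isVFunctor φ φ' := by
    refine (powTVGraph_hom Th X φ φ').le.trans (le_trans ?_ (powTVGraph_hom Th Y _ _).ge)
    exact le_iInf fun y => iInf_le _ (TFunctor.toFun f y)
  isTCompatible I h hh := by
    refine isTGraphMorphism_powGraph_iff.2 fun r y => ?_
    -- The criterion for `h` is applied to the image of `r` under `T (f × id)`, which leaves the
    -- index `α (T π₂ r)` unchanged.
    have h1 := isTGraphMorphism_powGraph_iff.1 hh
      (Th.map (fun z : Y.carrier × I.A => (TFunctor.toFun f z.1, z.2)) r) (TFunctor.toFun f y)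
    rw [Th.map_map, Th.map_map, Th.ext_map] at h1
    refine le_trans (mul_le_mul_left ?_ _) h1
    have h2 := TFunctor.isMorphism f (Th.map Prod.fst r) y
    rwa [Th.map_map] at h2
  preservesLims I φ h l _ _ hl := by
    have hl := (isLim_powTVGraph_iff Th X φ h l).1 hl
    exact (isLim_powTVGraph_iff Th Y φ _ _).2 fun y => hl (TFunctor.toFun f y)
  preservesTColims D c hc := by
    -- That the diagram is `T`-weighted matters here: it makes `c` pointwise, a property that
    -- composition with `f` keeps.
    have hc := (isColim_diagram_powTVGraph_iff D c).1 hc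
    exact isColim_powTVGraph_of_forall fun y => hc (TFunctor.toFun f y)

/-- The functor `X ↦ V^X` with values in `T`-frames. -/
def powFrameFunctor : (TCat Th)ᵒᵖ ⥤ TFrame Th where
  obj X := powFrame Th X.unop
  map f := powFrameMap Th f.unop

/-- The object parts of the two functors agree only propositionally, so their actions on morphisms
must be compared heterogeneously. -/
theorem VCont.Hom.heq_of_toFun {A A' B B' : VCont V} (hA : A = A') (hB : B = B')
    {f : VCont.Hom A B} {g : VCont.Hom A' B'} (h : f.toFun ≍ g.toFun) : f ≍ g := by
  subst hA hB
  exact heq_of_eq (VCont.Hom.ext (eq_of_heq h))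

theorem powFrameFunctor_comp_forget :
    powFrameFunctor Th ⋙ TFrame.forget Th = powFunctor Th := by
  have hobj : ∀ X, (powFrameFunctor Th ⋙ TFrame.forget Th).obj X = (powFunctor Th).obj X :=
    fun X => by
      have h : ∀ {A B : VCont V}, A.toVCat = B.toVCat → A = B := by
        rintro ⟨A, _⟩ ⟨B, _⟩ rfl
        rfl
      exact h (powTVGraph_toVCat Th X.unop)
  -- The carriers agree definitionally and both functors act by composition with `f`; only the hom
  -- structures had to be identified.
  exact Functor.hext hobj fun X Y f => VCont.Hom.heq_of_toFun (hobj X) (hobj Y) HEq.rfl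

end

theorem mainTheorem4 {V : Type u} [CommMonoid V] [CompleteLattice V] [IsQuantale V]
    (Th : StrictTopologicalTheory V) [Th.PointPreserving] :
    ∃ Ω : (TCat Th)ᵒᵖ ⥤ TFrame Th,
      Ω ⋙ TFrame.forget Th = powFunctor Th ∧
        ∀ X : (TCat Th)ᵒᵖ, (Ω.obj X).toTGraph = powGraph Th X.unop :=
  ⟨powFrameFunctor Th, powFrameFunctor_comp_forget Th, fun _ => rfl⟩
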